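/- Let $R$ be an associative unital ring. A torsion theory for right $R$-modules is a pair $\tau=(\mathcal T,\mathcal F)$ of classes of right $R$-modules that are maximal with the property that $\operatorname{Hom}_R(T,F)=0$ for all $T\in\mathcal T$, $F\in\mathcal F$; it is hereditary if $\mathcal T$ is closed under submodules. Let $\tau$ be a hereditary torsion theory with Gabriel filter $\mathfrak F=\{I \text{ a right ideal of } R : R/I\in\mathcal T\}$. For a right $R$-module $M$ let $\mathcal T(M)$ be the largest torsion submodule of $M$, let the module of quotients $M_{\mathfrak F}$ be the largest submodule $N$ of the injective envelope $E(M/\mathcal T(M))$ that contains $M/\mathcal T(M)$ and for which $N/(M/\mathcal T(M))$ is torsion, and let $q_M:M\to M_{\mathfrak F}$ be the composite $M\to M/\mathcal T(M)\hookrightarrow M_{\mathfrak F}$. Let $\Delta=\{\delta_n\}_{n\ge 0}$ be a higher derivation on $R$, that is, a family of additive maps $\delta_n:R\to R$ with $\delta_0=\mathrm{id}_R$ and $\delta_n(rs)=\sum_{i=0}^n\delta_i(r)\delta_{n-i}(s)$ for all $n\ge 0$ and $r,s\in R$. A $\Delta$-higher derivation on a right $R$-module $M$ is a family $\{d_n\}_{n\ge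 0}$ of additive maps $d_n:M\to M$ with $d_0=\mathrm{id}_M$ and $d_n(mr)=\sum_{i=0}^n d_i(m)\delta_{n-i}(r)$ for all $n\ge 0$, $m\in M$, $r\in R$. Then for every right $R$-module $M$ and every $\Delta$-higher derivation $\{d_n\}$ on $M$ there is exactly one $\Delta$-higher derivation $\{d_n'\}$ on $M_{\mathfrak F}$ such that $d_n' q_M=q_M d_n$ for all $n\ge 0$. -/

import Mathlib

open scoped RightActions

universe u

/-! A right `R`-module is a `Module Rᵐᵒᵖ M`, and a right ideal of `R` is an `Ideal Rᵐᵒᵖ`. The notions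
of torsion theory are written for (left) modules over a ring `A` and are used with `A = Rᵐᵒᵖ`. -/

/-! ### Torsion theories -/

/-- A torsion theory: a pair of classes of modules, the torsion and the torsion-free modules, which
are maximal with the property that `Hom(T, F) = 0` for all torsion `T` and torsion-free `F`. -/
structure TorsionTheory (A : Type u) [Ring A] where
  IsTorsion : ∀ (M : Type u) [AddCommGroup M] [Module A M], Prop
  IsTorsionFree : ∀ (M : Type u) [AddCommGroup M] [Module A M], Prop
  isTorsion_iff : ∀ (M : Type u) [AddCommGroup M] [Module A M],
    IsTorsion M ↔ ∀ (N : Type u) [AddCommGroup N] [Module A N],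
      IsTorsionFree N → ∀ f : M →ₗ[A] N, f = 0
  isTorsionFree_iff : ∀ (N : Type u) [AddCommGroup N] [Module A N],
    IsTorsionFree N ↔ ∀ (M : Type u) [AddCommGroup M] [Module A M],
      IsTorsion M → ∀ f : M →ₗ[A] N, f = 0

namespace TorsionTheory

variable {A : Type u} [Ring A] (τ : TorsionTheory A)

/-- A torsion theory is hereditary if submodules of torsion modules are torsion. -/
def IsHereditary : Prop :=
  ∀ (M : Type u) [AddCommGroup M] [Module A M], τ.IsTorsion M →
    ∀ N : Submodule A M, τ.IsTorsion N

variable {τ}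

lemma IsTorsion.of_surjective {M N : Type u} [AddCommGroup M] [Module A M] [AddCommGroup N]
    [Module A N] (h : τ.IsTorsion M) (f : M →ₗ[A] N) (hf : Function.Surjective f) :
    τ.IsTorsion N := by
  rw [τ.isTorsion_iff] at h ⊢
  intro Y _ _ hY g
  ext x
  obtain ⟨y, rfl⟩ := hf x
  exact LinearMap.congr_fun (h Y hY (g ∘ₗ f)) y

lemma IsHereditary.of_injective (hτ : τ.IsHereditary) {M N : Type u} [AddCommGroup M] [Module A M]
    [AddCommGroup N] [Module A N] (h : τ.IsTorsion N) (f : M →ₗ[A] N)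
    (hf : Function.Injective f) : τ.IsTorsion M :=
  (hτ N h (LinearMap.range f)).of_surjective (LinearEquiv.ofInjective f hf).symm.toLinearMap
    (LinearEquiv.ofInjective f hf).symm.surjective

lemma isTorsion_quotient_mono {I J : Ideal A} (h : τ.IsTorsion (A ⧸ I)) (hIJ : I ≤ J) :
    τ.IsTorsion (A ⧸ J) :=
  h.of_surjective (Submodule.factor hIJ) (Submodule.factor_surjective hIJ)

/-- A module is torsion if each of its elements is annihilated by some `I` with `A ⧸ I` torsion. -/
lemma isTorsion_of_forall {M : Type u} [AddCommGroup M] [Module A M]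
    (h : ∀ m : M, ∃ I : Ideal A, τ.IsTorsion (A ⧸ I) ∧ ∀ a ∈ I, a • m = 0) : τ.IsTorsion M := by
  rw [τ.isTorsion_iff]
  intro Y _ _ hY f
  ext m
  obtain ⟨I, hI, hm⟩ := h m
  have hle : I ≤ LinearMap.ker (LinearMap.toSpanSingleton A M m) := fun a ha => by
    simpa using hm a ha
  have h0 := (τ.isTorsion_iff _).1 hI Y hY (f ∘ₗ Submodule.liftQ I _ hle)
  have h1 := LinearMap.congr_fun h0 (Submodule.Quotient.mk 1)
  simpa [Submodule.liftQ_apply] using h1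

lemma isTorsion_quotient_of_colon {I J : Ideal A} (hJ : τ.IsTorsion (A ⧸ J))
    (h : ∀ x ∈ J, τ.IsTorsion (A ⧸ I.colon {x})) : τ.IsTorsion (A ⧸ I) := by
  rw [τ.isTorsion_iff]
  intro Y _ _ hY f
  have key : ∀ x ∈ J, f (Submodule.Quotient.mk x) = 0 := by
    intro x hx
    have hle : I.colon {x} ≤
        LinearMap.ker (LinearMap.toSpanSingleton A (A ⧸ I) (Submodule.Quotient.mk x)) := by
      intro a ha
      rw [Submodule.mem_colon_singleton] at ha
      rw [LinearMap.mem_ker, LinearMap.toSpanSingleton_apply, ← Submodule.Quotient.mk_smul]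
      exact (Submodule.Quotient.mk_eq_zero I).2 ha
    have h0 := (τ.isTorsion_iff _).1 (h x hx) Y hY (f ∘ₗ Submodule.liftQ _ _ hle)
    have h1 := LinearMap.congr_fun h0 (Submodule.Quotient.mk 1)
    simpa [Submodule.liftQ_apply] using h1
  have hle : J ≤ LinearMap.ker (f ∘ₗ I.mkQ) := fun x hx => by
    simpa using key x hx
  have h0 := (τ.isTorsion_iff _).1 hJ Y hY (Submodule.liftQ _ _ hle)
  refine Submodule.linearMap_qext _ (LinearMap.ext fun x => ?_)
  simpa using LinearMap.congr_fun h0 (Submodule.Quotient.mk x)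

lemma IsHereditary.isTorsion_quotient_colon (hτ : τ.IsHereditary) {I : Ideal A}
    (h : τ.IsTorsion (A ⧸ I)) (a : A) : τ.IsTorsion (A ⧸ I.colon {a}) := by
  have hle : I.colon {a} =
      LinearMap.ker (LinearMap.toSpanSingleton A (A ⧸ I) (Submodule.Quotient.mk a)) := by
    ext b
    rw [Submodule.mem_colon_singleton, LinearMap.mem_ker, LinearMap.toSpanSingleton_apply,
      ← Submodule.Quotient.mk_smul]
    exact (Submodule.Quotient.mk_eq_zero I).symm
  refine hτ.of_injective h (Submodule.liftQ _ _ hle.le) ?_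
  rw [← LinearMap.ker_eq_bot]
  exact Submodule.ker_liftQ_eq_bot _ _ _ hle.ge

/-- The filter of a hereditary torsion theory: all `I` such that `A ⧸ I` is torsion. -/
def gabrielFilter (τ : TorsionTheory A) (hτ : τ.IsHereditary) : IdealFilter A :=
  Order.IsPFilter.toPFilter (F := {I : Ideal A | τ.IsTorsion (A ⧸ I)}) <| by
    refine Order.IsPFilter.of_def ⟨⊤, ?_⟩ ?_ ?_
    · refine (τ.isTorsion_iff _).2 fun Y _ _ _ f => LinearMap.ext fun x => ?_
      rw [Subsingleton.elim x 0, map_zero, map_zero]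
    · intro I hI J hJ
      refine ⟨I ⊓ J, ?_, inf_le_left, inf_le_right⟩
      refine isTorsion_quotient_of_colon hI fun x hx => ?_
      refine isTorsion_quotient_mono (hτ.isTorsion_quotient_colon hJ x) fun a ha => ?_
      rw [Submodule.mem_colon_singleton] at ha ⊢
      exact ⟨I.smul_mem a hx, ha⟩
    · intro I J hIJ hI
      exact isTorsion_quotient_mono hI hIJ

lemma mem_gabrielFilter (hτ : τ.IsHereditary) {I : Ideal A} :
    I ∈ τ.gabrielFilter hτ ↔ τ.IsTorsion (A ⧸ I) := Iff.rfl

instance isGabriel_gabrielFilter (hτ : τ.IsHereditary) : (τ.gabrielFilter hτ).IsGabriel where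
  colon_mem hI a := hτ.isTorsion_quotient_colon hI a
  gabriel_closed I h := by
    obtain ⟨J, hJ, h⟩ := h
    exact isTorsion_quotient_of_colon hJ h

/-- Torsion with respect to `τ` is torsion with respect to the filter of `τ`. -/
theorem isTorsion_gabrielFilter_iff (hτ : τ.IsHereditary) (M : Type u) [AddCommGroup M]
    [Module A M] : (τ.gabrielFilter hτ).IsTorsion M ↔ τ.IsTorsion M := by
  refine ⟨fun h => isTorsion_of_forall h, fun h m => ?_⟩
  refine ⟨LinearMap.ker (LinearMap.toSpanSingleton A M m), ?_, fun a ha => by simpa using ha⟩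
  refine hτ.of_injective h (Submodule.liftQ _ (LinearMap.toSpanSingleton A M m) le_rfl) ?_
  rw [← LinearMap.ker_eq_bot]
  exact Submodule.ker_liftQ_eq_bot _ _ _ le_rfl

end TorsionTheory

/-! ### Injective envelopes -/

section InjectiveEnvelope

variable {A : Type u} [Ring A]

/-- `i : X → E` is an injective envelope: `E` is an injective module and `i` is an essential
monomorphism. -/
structure IsInjectiveEnvelope {X E : Type u} [AddCommGroup X] [Module A X] [AddCommGroup E]
    [Module A E] (i : X →ₗ[A] E) : Prop where
  injective_module : Module.Injective A E
  injective : Function.Injective i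
  essential : ∀ K : Submodule A E, K ⊓ LinearMap.range i = ⊥ → K = ⊥

/-- Among the submodules that meet `N` trivially there is a maximal one. -/
lemma exists_maximal_disjoint_submodule {J : Type u} [AddCommGroup J] [Module A J]
    (N : Submodule A J) : ∃ C : Submodule A J, Maximal (fun C => Disjoint C N) C := by
  obtain ⟨C, -, hC⟩ := zorn_le_nonempty₀ {C : Submodule A J | Disjoint C N} (fun c hc hchain y hy =>
    ⟨sSup c, by
      have := (hchain.directedOn.disjoint_sSup_left (a := N)).2 fun b hb => hc hb
      exact this, fun z hz => le_sSup hz⟩) ⊥ disjoint_bot_left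
  exact ⟨C, hC⟩

/-- A submodule `P` has a maximal essential extension in `J`. -/
lemma exists_maximal_essential_submodule {J : Type u} [AddCommGroup J] [Module A J]
    (P : Submodule A J) : ∃ N : Submodule A J,
      Maximal (fun N => P ≤ N ∧ ∀ K ≤ N, K ⊓ P = ⊥ → K = ⊥) N := by
  obtain ⟨N, -, hN⟩ := zorn_le_nonempty₀
    {N : Submodule A J | P ≤ N ∧ ∀ K ≤ N, K ⊓ P = ⊥ → K = ⊥} (fun c hc hchain y hy =>
    ⟨sSup c, ⟨(hc hy).1.trans (le_sSup hy), fun K hK hKP => by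
      rw [eq_bot_iff]
      intro x hx
      obtain ⟨N, hN, hxN⟩ :=
        (Submodule.mem_sSup_of_directed ⟨y, hy⟩ hchain.directedOn).1 (hK hx)
      have hspan : Submodule.span A {x} = ⊥ := by
        refine (hc hN).2 _ (by simpa using hxN) (eq_bot_iff.2 ?_)
        rw [← hKP]
        exact inf_le_inf_right _ (by simpa using hx)
      simpa using hspan⟩, fun z hz => le_sSup hz⟩) P
    ⟨le_rfl, fun K hK hKP => by rwa [inf_eq_left.2 hK] at hKP⟩
  exact ⟨N, hN⟩

/-- Every module has an injective envelope. -/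
theorem exists_isInjectiveEnvelope (X : Type u) [AddCommGroup X] [Module A X] :
    ∃ (E : ModuleCat.{u} A) (i : X →ₗ[A] E), IsInjectiveEnvelope i := by
  let J : ModuleCat.{u} A := CategoryTheory.Injective.under (ModuleCat.of A X)
  let f : X →ₗ[A] J := (CategoryTheory.Injective.ι (ModuleCat.of A X)).hom
  have hf : Function.Injective f :=
    (ModuleCat.mono_iff_injective (CategoryTheory.Injective.ι (ModuleCat.of A X))).1 inferInstance
  have hJ : Module.Injective A J :=
    Module.injective_module_of_injective_object A J
      (inj := inferInstanceAs (CategoryTheory.Injective J))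
  obtain ⟨N, hN⟩ := exists_maximal_essential_submodule (LinearMap.range f)
  obtain ⟨C, hC⟩ := exists_maximal_disjoint_submodule N
  have hker : LinearMap.ker (C.mkQ ∘ₗ N.subtype) = ⊥ := by
    rw [LinearMap.ker_comp, Submodule.ker_mkQ, ← Submodule.disjoint_iff_comap_eq_bot]
    exact hC.prop.symm
  obtain ⟨g, hg⟩ := hJ.out (C.mkQ ∘ₗ N.subtype) (LinearMap.ker_eq_bot.1 hker) N.subtype
  have hgN : ∀ x ∈ N, g (C.mkQ x) = x := fun x hx => hg ⟨x, hx⟩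
  have hgr : LinearMap.range g ≤ N := by
    refine hN.le_of_ge ⟨?_, ?_⟩ ?_
    · exact hN.prop.1.trans fun x hx => ⟨_, hgN x hx⟩
    · intro K hK hKP
      have hKN : K ⊓ N = ⊥ := hN.prop.2 _ inf_le_right (by
        rw [inf_assoc, inf_eq_right.2 hN.prop.1, hKP])
      have h1 : Disjoint (K.comap (g ∘ₗ C.mkQ)) N := by
        rw [Submodule.disjoint_def]
        intro x hx hxN
        have hxK : g (C.mkQ x) ∈ K := hx
        rw [hgN x hxN] at hxK
        have : x ∈ K ⊓ N := ⟨hxK, hxN⟩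
        simpa [hKN] using this
      have h2 : C ≤ K.comap (g ∘ₗ C.mkQ) := fun x hx => by
        have : C.mkQ x = 0 := by simpa using hx
        rw [Submodule.mem_comap, LinearMap.comp_apply, this, map_zero]
        exact K.zero_mem
      rw [eq_bot_iff]
      intro y hy
      obtain ⟨z, rfl⟩ := hK hy
      obtain ⟨x, rfl⟩ := C.mkQ_surjective z
      have hx : C.mkQ x = 0 := by simpa using hC.le_of_ge h1 h2 hy
      rw [hx, map_zero]
      exact Submodule.zero_mem _
    · exact fun x hx => ⟨_, hgN x hx⟩
  let p : J →ₗ[A] N := LinearMap.codRestrict N (g ∘ₗ C.mkQ) fun x => hgr ⟨_, rfl⟩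
  have hp : ∀ x : N, p x = x := fun x => Subtype.ext (hgN x x.2)
  refine ⟨ModuleCat.of A N, LinearMap.codRestrict N f fun x => hN.prop.1 ⟨x, rfl⟩, ?_, ?_, ?_⟩
  · refine ⟨fun Y Z _ _ _ _ a ha b => ?_⟩
    obtain ⟨h, hh⟩ := hJ.out a ha (N.subtype ∘ₗ b)
    exact ⟨p ∘ₗ h, fun x => by
      rw [LinearMap.comp_apply, hh x]
      exact hp (b x)⟩
  · exact fun x y hxy => hf (congrArg Subtype.val hxy)
  · intro K hK
    have h1 : K.map N.subtype = ⊥ := by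
      refine hN.prop.2 _ (Submodule.map_subtype_le N K) (eq_bot_iff.2 ?_)
      rintro _ ⟨⟨k, hk, rfl⟩, x, hx⟩
      have : k ∈ K ⊓ LinearMap.range (LinearMap.codRestrict N f fun x => hN.prop.1 ⟨x, rfl⟩) :=
        ⟨hk, x, Subtype.ext hx⟩
      have h0 : k ∈ (⊥ : Submodule A N) := hK ▸ this
      rw [(Submodule.mem_bot A).1 h0]
      simp
    exact Submodule.map_injective_of_injective N.injective_subtype (by rw [h1, Submodule.map_bot])

/-- The injective envelope `E(X)`. -/
noncomputable def injectiveEnvelope (A : Type u) [Ring A] (X : Type u) [AddCommGroup X]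
    [Module A X] : ModuleCat.{u} A :=
  (exists_isInjectiveEnvelope (A := A) X).choose

/-- The embedding `X → E(X)`. -/
noncomputable def toInjectiveEnvelope (A : Type u) [Ring A] (X : Type u) [AddCommGroup X]
    [Module A X] : X →ₗ[A] injectiveEnvelope A X :=
  (exists_isInjectiveEnvelope (A := A) X).choose_spec.choose

theorem isInjectiveEnvelope_toInjectiveEnvelope (X : Type u) [AddCommGroup X] [Module A X] :
    IsInjectiveEnvelope (toInjectiveEnvelope A X) :=
  (exists_isInjectiveEnvelope (A := A) X).choose_spec.choose_spec

end InjectiveEnvelope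

/-! ### Modules of quotients -/

namespace IdealFilter

variable {A : Type u} [Ring A] (F : IdealFilter A) [F.IsGabriel]

/-- The torsion submodule of `M`; it is the largest torsion submodule, see
`isGreatest_torsionSubmodule`. -/
def torsionSubmodule (M : Type u) [AddCommGroup M] [Module A M] : Submodule A M where
  carrier := {m | F.IsTorsionElem m}
  zero_mem' := by
    obtain ⟨L, hL⟩ := F.nonempty
    exact ⟨L, hL, fun a _ => smul_zero a⟩
  add_mem' := by
    rintro x y ⟨L, hL, hx⟩ ⟨L', hL', hy⟩
    exact ⟨L ⊓ L', Order.PFilter.inf_mem hL hL', fun a ha => by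
      rw [smul_add, hx a ha.1, hy a ha.2, add_zero]⟩
  smul_mem' := by
    rintro b x ⟨L, hL, hx⟩
    exact ⟨L.colon {b}, IsUniform.colon_mem hL b, fun a ha => by
      rw [smul_smul]; exact hx _ (Submodule.mem_colon_singleton.1 ha)⟩

theorem isGreatest_torsionSubmodule (M : Type u) [AddCommGroup M] [Module A M] :
    IsGreatest {N : Submodule A M | F.IsTorsion N} (F.torsionSubmodule M) := by
  refine ⟨?_, ?_⟩
  · rintro ⟨m, L, hL, hm⟩
    exact ⟨L, hL, fun a ha => Subtype.ext (hm a ha)⟩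
  · intro N hN m hm
    obtain ⟨L, hL, h⟩ := hN ⟨m, hm⟩
    exact ⟨L, hL, fun a ha => congrArg Subtype.val (h a ha)⟩

/-- The closure of a submodule `N` of `E`: the largest submodule `K` of `E` containing `N` such
that `K / N` is torsion, see `isGreatest_closure`. -/
def closure {E : Type u} [AddCommGroup E] [Module A E] (N : Submodule A E) : Submodule A E where
  carrier := {x | N.colon {x} ∈ F}
  zero_mem' := by
    obtain ⟨L, hL⟩ := F.nonempty
    exact Order.PFilter.mem_of_le (fun a _ => by simp) hL
  add_mem' := by
    intro x y hx hy
    refine Order.PFilter.mem_of_le (fun a ha => ?_) (Order.PFilter.inf_mem hx hy)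
    have h1 := Submodule.mem_colon_singleton.1 ha.1
    have h2 := Submodule.mem_colon_singleton.1 ha.2
    refine Submodule.mem_colon_singleton.2 ?_
    rw [smul_add]
    exact N.add_mem h1 h2
  smul_mem' := by
    intro b x hx
    refine Order.PFilter.mem_of_le (fun a ha => ?_) (IsUniform.colon_mem hx b)
    have h1 := Submodule.mem_colon_singleton.1 (Submodule.mem_colon_singleton.1 ha)
    refine Submodule.mem_colon_singleton.2 ?_
    rwa [smul_smul]

theorem le_closure {E : Type u} [AddCommGroup E] [Module A E] (N : Submodule A E) :
    N ≤ F.closure N := by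
  intro x hx
  obtain ⟨L, hL⟩ := F.nonempty
  exact Order.PFilter.mem_of_le
    (fun a _ => Submodule.mem_colon_singleton.2 (N.smul_mem a hx)) hL

theorem isGreatest_closure {E : Type u} [AddCommGroup E] [Module A E] (N : Submodule A E) :
    IsGreatest {K : Submodule A E | N ≤ K ∧ F.IsTorsion (K ⧸ N.comap K.subtype)}
      (F.closure N) := by
  refine ⟨⟨F.le_closure N, ?_⟩, ?_⟩
  · intro y
    obtain ⟨⟨x, hx⟩, rfl⟩ := Submodule.Quotient.mk_surjective _ y
    refine ⟨N.colon {x}, hx, fun a ha => ?_⟩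
    rw [← Submodule.Quotient.mk_smul, Submodule.Quotient.mk_eq_zero]
    have h1 : a • x ∈ N := Submodule.mem_colon_singleton.1 ha
    exact h1
  · rintro K ⟨-, hK⟩ x hx
    obtain ⟨L, hL, h⟩ := hK (Submodule.Quotient.mk ⟨x, hx⟩)
    refine Order.PFilter.mem_of_le (fun a ha => ?_) hL
    have h1 := h a ha
    rw [← Submodule.Quotient.mk_smul, Submodule.Quotient.mk_eq_zero] at h1
    exact Submodule.mem_colon_singleton.2 h1

/-- The module of quotients `M_F`: the closure of `M / T(M)` in its injective envelope
`E(M / T(M))`. -/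
noncomputable def moduleOfQuotients (M : Type u) [AddCommGroup M] [Module A M] :
    Submodule A (injectiveEnvelope A (M ⧸ F.torsionSubmodule M)) :=
  F.closure (LinearMap.range (toInjectiveEnvelope A (M ⧸ F.torsionSubmodule M)))

/-- The canonical map `q_M : M → M_F`, the composite `M → M / T(M) → M_F`. -/
noncomputable def toModuleOfQuotients (M : Type u) [AddCommGroup M] [Module A M] :
    M →ₗ[A] F.moduleOfQuotients M :=
  LinearMap.codRestrict _ (toInjectiveEnvelope A (M ⧸ F.torsionSubmodule M))
    (fun x => F.le_closure _ (LinearMap.mem_range_self _ x)) ∘ₗ (F.torsionSubmodule M).mkQ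

end IdealFilter

/-! ### Higher derivations -/

/-- A higher derivation on a ring `R`. -/
structure HigherDerivation (R : Type u) [Ring R] where
  δ : ℕ → R →+ R
  δ_zero : δ 0 = AddMonoidHom.id R
  leibniz : ∀ (n : ℕ) (r s : R),
    δ n (r * s) = ∑ i ∈ Finset.range (n + 1), δ i r * δ (n - i) s

/-- A family of additive maps `d n` on a right `R`-module `M` is a `Δ`-higher derivation.
Here `m <• r` is the right action of `r` on `m`. -/
structure HigherDerivation.IsModuleHD {R : Type u} [Ring R] (Δ : HigherDerivation R)
    {M : Type u} [AddCommGroup M] [Module Rᵐᵒᵖ M] (d : ℕ → M →+ M) : Prop where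
  zero : d 0 = AddMonoidHom.id M
  leibniz : ∀ (n : ℕ) (m : M) (r : R),
    d n (m <• r) = ∑ i ∈ Finset.range (n + 1), d i m <• Δ.δ (n - i) r

/-! ### Closed modules -/

/-! Let `r` act on power series with coefficients in a right module `N` as multiplication by `∑
δₙ(r) xⁿ`. In degree `n`, linearity of a map `N → N⟦x⟧` is the Leibniz rule for its coefficients, so
a higher derivation on `N` is exactly a linear map `N → N⟦x⟧` with constant coefficient the
identity. The theorem thus asks to extend the linear map `m ↦ ∑ q(dₙ m) xⁿ` uniquely along `q : M →
M_F`.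

Since `q` has torsion kernel and cokernel, every linear map from `M` into a closed module extends
uniquely along `q` (`exists_extension`, `linearMap_ext`). It remains that `M_F` is closed and that
`N⟦x⟧` inherits closedness from `N`. The latter holds degree by degree, because the action on a
lowest coefficient is untwisted. No compatibility of the `δₙ` with the filter is needed. -/

namespace IdealFilter

variable {A : Type u} [Ring A] (F : IdealFilter A)

/-- A module `P` is closed with respect to `F` if it has no nonzero `F`-torsion elements and every
linear map `I → P` with `I ∈ F` is the multiplication by an element of `P`. -/
structure IsClosedModule (P : Type u) [AddCommGroup P] [Module A P] : Prop where
  eq_zero : ∀ p : P, F.IsTorsionElem p → p = 0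
  exists_smul : ∀ I ∈ F, ∀ f : I →ₗ[A] P, ∃ p : P, ∀ a : I, f a = (a : A) • p

variable {F}

lemma IsClosedModule.eq_of_smul_eq {P : Type u} [AddCommGroup P] [Module A P]
    (hP : F.IsClosedModule P) {I : Ideal A} (hI : I ∈ F) {p p' : P}
    (h : ∀ a ∈ I, a • p = a • p') : p = p' :=
  sub_eq_zero.1 <| hP.eq_zero _ ⟨I, hI, fun a ha => by rw [smul_sub, h a ha, sub_self]⟩

/-! ### Extending linear maps into closed modules -/

section Extension

variable {M Q P : Type u} [AddCommGroup M] [Module A M] [AddCommGroup Q] [Module A Q]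
  [AddCommGroup P] [Module A P]

/-- Linear maps into a closed module that agree on a submodule with torsion quotient are equal. -/
lemma IsClosedModule.linearMap_ext (hP : F.IsClosedModule P) (q : M →ₗ[A] Q)
    (hcoker : ∀ x : Q, (LinearMap.range q).colon {x} ∈ F) {f g : Q →ₗ[A] P}
    (h : f ∘ₗ q = g ∘ₗ q) : f = g := by
  ext x
  refine hP.eq_of_smul_eq (hcoker x) fun a ha => ?_
  obtain ⟨m, hm⟩ := Submodule.mem_colon_singleton.1 ha
  rw [← map_smul, ← map_smul, ← hm]
  exact LinearMap.congr_fun h m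

/-- A linear map into a closed module extends along a linear map with torsion kernel and
cokernel. -/
theorem IsClosedModule.exists_extension (hP : F.IsClosedModule P) (q : M →ₗ[A] Q)
    (hker : ∀ m, q m = 0 → F.IsTorsionElem m)
    (hcoker : ∀ x : Q, (LinearMap.range q).colon {x} ∈ F) (D : M →ₗ[A] P) :
    ∃ D' : Q →ₗ[A] P, D' ∘ₗ q = D := by
  -- The kernel of `q` is torsion and `P` is torsion-free, so `D m` depends only on `q m`.
  have hD : ∀ m m', q m = q m' → D m = D m' := by
    intro m m' h
    obtain ⟨L, hL, hm⟩ := hker (m - m') (by rw [map_sub, h, sub_self])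
    rw [← sub_eq_zero, ← map_sub]
    exact hP.eq_zero _ ⟨L, hL, fun a ha => by rw [← map_smul, hm a ha, map_zero]⟩
  have hex : ∀ x : Q, ∃ p : P, ∀ (a : A) (m : M), q m = a • x → D m = a • p := by
    intro x
    have hmem : ∀ a : (LinearMap.range q).colon {x}, ∃ m, q m = (a : A) • x := fun a =>
      Submodule.mem_colon_singleton.1 a.2
    -- The choice `s` need not be linear, but `D ∘ s` is, by `hD`. The resulting `p` is the forced
    -- value at `x`.
    choose s hs using hmem
    obtain ⟨p, hp⟩ := hP.exists_smul _ (hcoker x)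
      { toFun := fun a => D (s a)
        map_add' := fun a b => by
          rw [← map_add]
          exact hD _ _ (by rw [map_add, hs, hs, hs, Submodule.coe_add, add_smul])
        map_smul' := fun b a => by
          rw [RingHom.id_apply, ← map_smul]
          exact hD _ _ (by rw [map_smul, hs, hs, Submodule.coe_smul, smul_assoc]) }
    refine ⟨p, fun a m ham => ?_⟩
    have ha : a ∈ (LinearMap.range q).colon {x} := Submodule.mem_colon_singleton.2 ⟨m, ham⟩
    rw [← hp ⟨a, ha⟩]
    exact hD _ _ (by rw [hs, ham])
  choose E hE using hex
  refine ⟨{ toFun := E, map_add' := fun x y => ?_, map_smul' := fun b x => ?_ }, ?_⟩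
  · refine hP.eq_of_smul_eq (Order.PFilter.inf_mem (hcoker x) (hcoker y)) fun a ha => ?_
    obtain ⟨m, hm⟩ := Submodule.mem_colon_singleton.1 ha.1
    obtain ⟨m', hm'⟩ := Submodule.mem_colon_singleton.1 ha.2
    rw [smul_add, ← hE x a m hm, ← hE y a m' hm', ← map_add]
    exact (hE (x + y) a (m + m') (by rw [map_add, hm, hm', smul_add])).symm
  · refine hP.eq_of_smul_eq (hcoker (b • x)) fun a ha => ?_
    obtain ⟨m, hm⟩ := Submodule.mem_colon_singleton.1 ha
    rw [← hE _ a m hm, RingHom.id_apply, smul_smul]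
    exact hE x (a * b) m (by rw [hm, smul_smul])
  · ext m
    have := hE (q m) 1 m (one_smul _ _).symm
    rw [one_smul] at this
    exact this.symm

end Extension

/-! ### Closedness of the module of quotients -/

variable (F) [F.IsGabriel] (M : Type u) [AddCommGroup M] [Module A M]

/-- The closure of a submodule is closed. -/
lemma closure_closure_le {E : Type u} [AddCommGroup E] [Module A E] (N : Submodule A E) :
    F.closure (F.closure N) ≤ F.closure N := by
  intro x hx
  refine IsGabriel.gabriel_closed _ ⟨_, hx, fun a ha => ?_⟩
  refine Order.PFilter.mem_of_le (fun b hb => ?_)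
    (show N.colon {a • x} ∈ F from Submodule.mem_colon_singleton.1 ha)
  refine Submodule.mem_colon_singleton.2 (Submodule.mem_colon_singleton.2 ?_)
  rw [smul_assoc]
  exact Submodule.mem_colon_singleton.1 hb

/-- If `L` carries `m` into the torsion submodule, then `(ann m : a)` is in `F` for each `a ∈ L`,
and the Gabriel condition puts `ann m` itself in `F`. -/
lemma eq_zero_of_isTorsionElem_quotient (y : M ⧸ F.torsionSubmodule M) (hy : F.IsTorsionElem y) :
    y = 0 := by
  obtain ⟨m, rfl⟩ := Submodule.Quotient.mk_surjective _ y
  obtain ⟨L, hL, h⟩ := hy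
  rw [Submodule.Quotient.mk_eq_zero]
  refine ⟨LinearMap.ker (LinearMap.toSpanSingleton A M m), ?_, fun a ha => by simpa using ha⟩
  refine IsGabriel.gabriel_closed _ ⟨L, hL, fun a ha => ?_⟩
  have h1 := h a ha
  rw [← Submodule.Quotient.mk_smul, Submodule.Quotient.mk_eq_zero] at h1
  obtain ⟨K, hK, h2⟩ := h1
  refine Order.PFilter.mem_of_le (fun b hb => Submodule.mem_colon_singleton.2 ?_) hK
  rw [LinearMap.mem_ker, LinearMap.toSpanSingleton_apply, smul_assoc]
  exact h2 b hb

/-- An essential extension of a torsion-free module is torsion-free. -/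
lemma eq_zero_of_essential {X E : Type u} [AddCommGroup X] [Module A X] [AddCommGroup E]
    [Module A E] {i : X →ₗ[A] E} (hi : IsInjectiveEnvelope i)
    (hX : ∀ x : X, F.IsTorsionElem x → x = 0) (e : E) (he : F.IsTorsionElem e) : e = 0 := by
  have hbot : F.torsionSubmodule E = ⊥ := by
    refine hi.essential _ (eq_bot_iff.2 ?_)
    rintro _ ⟨⟨L, hL, h⟩, x, rfl⟩
    have : x = 0 := hX x ⟨L, hL, fun a ha => hi.injective (by rw [map_smul, h a ha, map_zero])⟩
    rw [this, map_zero]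
    exact Submodule.zero_mem _
  have : e ∈ F.torsionSubmodule E := he
  rwa [hbot, Submodule.mem_bot] at this

/-- The module of quotients is closed. -/
theorem isClosedModule_moduleOfQuotients : F.IsClosedModule (F.moduleOfQuotients M) where
  eq_zero := by
    rintro ⟨e, he⟩ ⟨L, hL, h⟩
    refine Subtype.ext (F.eq_zero_of_essential (isInjectiveEnvelope_toInjectiveEnvelope _)
      (F.eq_zero_of_isTorsionElem_quotient M) e ⟨L, hL, fun a ha => ?_⟩)
    exact congrArg Subtype.val (h a ha)
  exists_smul := by
    intro I hI f
    obtain ⟨g, hg⟩ := (isInjectiveEnvelope_toInjectiveEnvelope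
      (A := A) (M ⧸ F.torsionSubmodule M)).injective_module.out I.subtype I.injective_subtype
      ((F.moduleOfQuotients M).subtype ∘ₗ f)
    have hg1 : ∀ a : I, (f a : injectiveEnvelope A (M ⧸ F.torsionSubmodule M)) =
        (a : A) • g 1 := fun a => by
      rw [← map_smul, smul_eq_mul, mul_one]
      exact (hg a).symm
    -- The extension `g` to the whole ring is determined by `g 1`. As `I` carries `g 1` into `M_F`,
    -- it lies in the closure of `M_F`, which is `M_F`.
    refine ⟨⟨g 1, F.closure_closure_le _ (Order.PFilter.mem_of_le (fun a ha => ?_) hI)⟩,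
      fun a => Subtype.ext (hg1 a)⟩
    refine Submodule.mem_colon_singleton.2 ?_
    rw [← hg1 ⟨a, ha⟩]
    exact (f ⟨a, ha⟩).2

lemma isTorsionElem_of_toModuleOfQuotients_eq_zero (m : M)
    (h : F.toModuleOfQuotients M m = 0) : F.IsTorsionElem m := by
  have h1 : toInjectiveEnvelope A (M ⧸ F.torsionSubmodule M) (Submodule.Quotient.mk m) = 0 :=
    congrArg Subtype.val h
  exact (Submodule.Quotient.mk_eq_zero (F.torsionSubmodule M)).1
    ((isInjectiveEnvelope_toInjectiveEnvelope _).injective (h1.trans (map_zero _).symm))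

lemma colon_range_toModuleOfQuotients_mem (x : F.moduleOfQuotients M) :
    (LinearMap.range (F.toModuleOfQuotients M)).colon {x} ∈ F := by
  refine Order.PFilter.mem_of_le (fun a ha => ?_) x.2
  obtain ⟨y, hy⟩ := Submodule.mem_colon_singleton.1 ha
  obtain ⟨m, rfl⟩ := Submodule.Quotient.mk_surjective _ y
  exact Submodule.mem_colon_singleton.2 ⟨m, Subtype.ext hy⟩

end IdealFilter

/-! ### Twisted power series -/

namespace HigherDerivation

open Finset MulOpposite

variable {R : Type u} [Ring R] (Δ : HigherDerivation R)

lemma leibniz_antidiagonal (n : ℕ) (r s : R) :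
    Δ.δ n (r * s) = ∑ ij ∈ antidiagonal n, Δ.δ ij.1 r * Δ.δ ij.2 s := by
  rw [Δ.leibniz, Nat.sum_antidiagonal_eq_sum_range_succ (fun i j => Δ.δ i r * Δ.δ j s)]

lemma δ_zero_apply (r : R) : Δ.δ 0 r = r := by rw [Δ.δ_zero, AddMonoidHom.id_apply]

/-- In the expansion of `δ (n + 1) (1 * 1)` the middle terms vanish by induction and each end term
is `δ (n + 1) 1`. -/
lemma δ_succ_one (n : ℕ) : Δ.δ (n + 1) 1 = 0 := by
  induction n using Nat.strong_induction_on with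
  | _ n ih =>
    have h := Δ.leibniz (n + 1) 1 1
    rw [sum_range_succ, sum_range_succ', sum_eq_zero, mul_one, Nat.sub_self, Nat.sub_zero,
      Δ.δ_zero_apply, one_mul, mul_one, zero_add] at h
    · exact left_eq_add.1 h
    · intro i hi
      rw [ih i (mem_range.1 hi), zero_mul]

/-- Power series `∑ mₙ xⁿ` with coefficients in a right `R`-module `N`, on which `r : R` acts as
multiplication by `∑ δₙ(r) xⁿ`. -/
@[nolint unusedArguments]
def TwistedSeries (_ : HigherDerivation R) (N : Type u) : Type u := ℕ → N

namespace TwistedSeries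

variable {Δ} {N : Type u}

@[ext] lemma ext {p p' : Δ.TwistedSeries N} (h : ∀ n, p n = p' n) : p = p' := funext h

variable [AddCommGroup N]

instance : AddCommGroup (Δ.TwistedSeries N) := inferInstanceAs (AddCommGroup (ℕ → N))

@[simp] lemma zero_apply (n : ℕ) : (0 : Δ.TwistedSeries N) n = 0 := rfl

@[simp] lemma add_apply (p p' : Δ.TwistedSeries N) (n : ℕ) : (p + p') n = p n + p' n := rfl

@[simp] lemma sub_apply (p p' : Δ.TwistedSeries N) (n : ℕ) : (p - p') n = p n - p' n := rfl

/-- The series with a single coefficient `x` in degree `n`. -/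
def single (Δ : HigherDerivation R) (n : ℕ) (x : N) : Δ.TwistedSeries N :=
  fun k => if k = n then x else 0

lemma single_same (n : ℕ) (x : N) : single Δ n x n = x := if_pos rfl

lemma single_of_lt {n k : ℕ} (h : k < n) (x : N) : single Δ n x k = 0 := if_neg h.ne

variable [Module Rᵐᵒᵖ N]

instance : SMul Rᵐᵒᵖ (Δ.TwistedSeries N) where
  smul a p := fun n => ∑ ij ∈ antidiagonal n, op (Δ.δ ij.2 (unop a)) • p ij.1

lemma smul_apply_antidiagonal (a : Rᵐᵒᵖ) (p : Δ.TwistedSeries N) (n : ℕ) :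
    (a • p) n = ∑ ij ∈ antidiagonal n, op (Δ.δ ij.2 (unop a)) • p ij.1 := rfl

lemma smul_apply (a : Rᵐᵒᵖ) (p : Δ.TwistedSeries N) (n : ℕ) :
    (a • p) n = ∑ i ∈ range (n + 1), op (Δ.δ (n - i) (unop a)) • p i :=
  Nat.sum_antidiagonal_eq_sum_range_succ (fun i j => op (Δ.δ j (unop a)) • p i) n

/-- Only the term with `δ 0` survives. This is what reduces statements about the twisted action to
`N`, one degree at a time. -/
lemma smul_apply_of_forall_lt (a : Rᵐᵒᵖ) {p : Δ.TwistedSeries N} {n : ℕ}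
    (h : ∀ i < n, p i = 0) : (a • p) n = a • p n := by
  rw [smul_apply, sum_range_succ, sum_eq_zero, zero_add, Nat.sub_self, δ_zero_apply, op_unop]
  intro i hi
  rw [h i (mem_range.1 hi), smul_zero]

lemma smul_assoc_apply (a b : Rᵐᵒᵖ) (p : Δ.TwistedSeries N) : (a * b) • p = a • b • p := by
  ext n
  simp only [smul_apply_antidiagonal, unop_mul, leibniz_antidiagonal, op_sum, op_mul, sum_smul,
    mul_smul, smul_sum, sum_sigma']
  -- Both sides sum over triples of degrees, for `p`, `b` and `a`, with total `n`. The left groups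
  -- those of `b` and `a`, the right those of `p` and `b`.
  refine sum_nbij' (fun x => ⟨(x.1.1 + x.2.1, x.2.2), (x.1.1, x.2.1)⟩)
    (fun x => ⟨(x.2.1, x.2.2 + x.1.2), (x.2.2, x.1.2)⟩) ?_ ?_ ?_ ?_ ?_
  · rintro ⟨⟨i, j⟩, ⟨k, l⟩⟩ h
    simp only [mem_sigma, HasAntidiagonal.mem_antidiagonal, and_true] at h ⊢
    omega
  · rintro ⟨⟨i, j⟩, ⟨k, l⟩⟩ h
    simp only [mem_sigma, HasAntidiagonal.mem_antidiagonal, and_true] at h ⊢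
    omega
  · rintro ⟨⟨i, j⟩, ⟨k, l⟩⟩ h
    simp only [mem_sigma, HasAntidiagonal.mem_antidiagonal] at h
    obtain ⟨-, rfl⟩ := h
    rfl
  · rintro ⟨⟨i, j⟩, ⟨k, l⟩⟩ h
    simp only [mem_sigma, HasAntidiagonal.mem_antidiagonal] at h
    obtain ⟨-, rfl⟩ := h
    rfl
  · rintro ⟨⟨i, j⟩, ⟨k, l⟩⟩ h
    rfl

instance : Module Rᵐᵒᵖ (Δ.TwistedSeries N) where
  one_smul p := by
    ext n
    rw [smul_apply, sum_range_succ, sum_eq_zero, zero_add, Nat.sub_self, δ_zero_apply, op_unop,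
      one_smul]
    intro i hi
    obtain ⟨k, hk⟩ := Nat.exists_eq_add_of_lt (mem_range.1 hi)
    rw [show n - i = k + 1 by omega, unop_one, δ_succ_one, op_zero, zero_smul]
  mul_smul := smul_assoc_apply
  smul_zero a := by ext n; simp [smul_apply]
  smul_add a p p' := by ext n; simp [smul_apply, sum_add_distrib]
  add_smul a b p := by ext n; simp [smul_apply, add_smul, sum_add_distrib]
  zero_smul p := by ext n; simp [smul_apply]

/-! ### Closedness of twisted power series -/

variable {F : IdealFilter Rᵐᵒᵖ}

/-- If the coefficients are torsion-free, an initial segment of a series vanishes as soon as it is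
annihilated by a member of the filter. -/
lemma apply_eq_zero_of_forall_smul (hN : F.IsClosedModule N) {I : Ideal Rᵐᵒᵖ} (hI : I ∈ F)
    {p : Δ.TwistedSeries N} (n : ℕ) (h : ∀ k ≤ n, ∀ a ∈ I, (a • p) k = 0) : p n = 0 := by
  induction n using Nat.strong_induction_on with
  | _ n ih =>
    refine hN.eq_zero _ ⟨I, hI, fun a ha => ?_⟩
    rw [← smul_apply_of_forall_lt a fun i hi => ih i hi fun k hk => h k (hk.trans hi.le)]
    exact h n le_rfl a ha

/-- Once `p` represents `f` below degree `n`, the remainder `g` starts in degree `n`, so its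
coefficient there is linear into `N`. Closedness of `N` represents it by some `x`, and adding `x` in
degree `n` leaves lower degrees unchanged. -/
lemma exists_smul_apply_eq (hN : F.IsClosedModule N) {I : Ideal Rᵐᵒᵖ} (hI : I ∈ F)
    (f : I →ₗ[Rᵐᵒᵖ] Δ.TwistedSeries N) (n : ℕ) :
    ∃ p : Δ.TwistedSeries N, ∀ k < n, ∀ a : I, f a k = ((a : Rᵐᵒᵖ) • p) k := by
  induction n with
  | zero => exact ⟨0, fun k hk => absurd hk (Nat.not_lt_zero k)⟩
  | succ n ih =>
    obtain ⟨p, hp⟩ := ih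
    let g : I →ₗ[Rᵐᵒᵖ] Δ.TwistedSeries N :=
      f - (LinearMap.toSpanSingleton Rᵐᵒᵖ _ p) ∘ₗ I.subtype
    have hg : ∀ a k, g a k = f a k - ((a : Rᵐᵒᵖ) • p) k := fun a k => rfl
    have hg0 : ∀ a, ∀ k < n, g a k = 0 := fun a k hk => by rw [hg, hp k hk, sub_self]
    obtain ⟨x, hx⟩ := hN.exists_smul I hI
      { toFun := fun a => g a n
        map_add' := fun a b => by rw [map_add, add_apply]
        map_smul' := fun b a => by
          rw [map_smul, smul_apply_of_forall_lt b (hg0 a), RingHom.id_apply] }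
    refine ⟨p + single Δ n x, fun k hk a => ?_⟩
    rw [smul_add, add_apply, ← sub_eq_iff_eq_add', ← hg]
    have hs : ∀ i < n, single Δ n x i = 0 := fun i hi => single_of_lt hi x
    rcases (Nat.lt_succ_iff.1 hk).lt_or_eq with hk | rfl
    · rw [hg0 a k hk, smul_apply_of_forall_lt _ fun i hi => hs i (hi.trans hk), hs k hk, smul_zero]
    · rw [smul_apply_of_forall_lt _ hs, single_same]
      exact hx a

/-- Twisted power series with coefficients in a closed module form a closed module. -/
theorem isClosedModule (hN : F.IsClosedModule N) : F.IsClosedModule (Δ.TwistedSeries N) where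
  eq_zero := by
    rintro p ⟨I, hI, h⟩
    ext n
    exact apply_eq_zero_of_forall_smul hN hI n fun k _ a ha => by rw [h a ha, zero_apply]
  exists_smul := by
    intro I hI f
    choose P hP using fun n => exists_smul_apply_eq hN hI f (n + 1)
    -- `P k` and `P n` both represent `f` through degree `k`, so `I` annihilates their difference
    -- there. The diagonal `p` therefore agrees with `P n` through degree `n`, which is all that
    -- degree `n` of `a • p` involves.
    have hPk : ∀ n, ∀ k ≤ n, P k k = P n k := by
      intro n k hk
      rw [← sub_eq_zero, ← sub_apply]
      refine apply_eq_zero_of_forall_smul hN hI k fun j hj a ha => ?_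
      rw [smul_sub, sub_apply, ← hP k j (by omega) ⟨a, ha⟩, ← hP n j (by omega) ⟨a, ha⟩, sub_self]
    let p : Δ.TwistedSeries N := fun n => P n n
    refine ⟨p, fun a => ext fun n => ?_⟩
    rw [hP n n n.lt_succ_self a, smul_apply, smul_apply]
    exact sum_congr rfl fun k hk =>
      congrArg (_ • ·) (hPk n k (Nat.lt_succ_iff.1 (mem_range.1 hk))).symm

end TwistedSeries

/-! ### Higher derivations on modules as linear maps -/

variable {Δ} {M N : Type u} [AddCommGroup M] [Module Rᵐᵒᵖ M] [AddCommGroup N] [Module Rᵐᵒᵖ N]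

/-- The linear map `m ↦ ∑ f(dₙ(m)) xⁿ` for a higher derivation `d` on `M` and a linear map
`f : M → N`. -/
def IsModuleHD.toSeries {d : ℕ → M →+ M} (hd : Δ.IsModuleHD d) (f : M →ₗ[Rᵐᵒᵖ] N) :
    M →ₗ[Rᵐᵒᵖ] Δ.TwistedSeries N where
  toFun m := fun n => f (d n m)
  map_add' m m' := by
    refine TwistedSeries.ext fun n => ?_
    exact (congrArg f (map_add (d n) m m')).trans (map_add f _ _)
  map_smul' a m := by
    refine TwistedSeries.ext fun n => ?_
    have h := hd.leibniz n m (unop a)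
    rw [op_unop] at h
    refine (congrArg f h).trans (((map_sum f _ _).trans ?_).trans
      (TwistedSeries.smul_apply a _ n).symm)
    exact sum_congr rfl fun i _ => map_smul f _ _

/-- The family of coefficients of a linear map `N → N⟦x⟧`. -/
def coeffs (D : N →ₗ[Rᵐᵒᵖ] Δ.TwistedSeries N) (n : ℕ) : N →+ N where
  toFun x := D x n
  map_zero' := by rw [map_zero, TwistedSeries.zero_apply]
  map_add' x y := by rw [map_add, TwistedSeries.add_apply]

/-- The constant coefficient of a linear map into twisted series, as a linear map. -/
def constCoeff (D : N →ₗ[Rᵐᵒᵖ] Δ.TwistedSeries N) : N →ₗ[Rᵐᵒᵖ] N where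
  toFun x := D x 0
  map_add' x y := by rw [map_add, TwistedSeries.add_apply]
  map_smul' a x := by
    rw [map_smul, TwistedSeries.smul_apply_of_forall_lt a fun i hi => absurd hi (Nat.not_lt_zero i),
      RingHom.id_apply]

/-- The Leibniz rule is the linearity of `D` read in degree `n`; only `d 0 = id` is an extra
condition. -/
lemma isModuleHD_coeffs (D : N →ₗ[Rᵐᵒᵖ] Δ.TwistedSeries N) (h : constCoeff D = LinearMap.id) :
    Δ.IsModuleHD (coeffs D) where
  zero := AddMonoidHom.ext fun x => LinearMap.congr_fun h x
  leibniz n x r := by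
    change D (op r • x) n = _
    rw [map_smul, TwistedSeries.smul_apply, unop_op]
    rfl

/-- A higher derivation extends uniquely along a linear map with torsion kernel and cokernel into a
closed module. -/
theorem IsModuleHD.existsUnique_extension {F : IdealFilter Rᵐᵒᵖ} (hN : F.IsClosedModule N)
    (q : M →ₗ[Rᵐᵒᵖ] N) (hker : ∀ m, q m = 0 → F.IsTorsionElem m)
    (hcoker : ∀ x : N, (LinearMap.range q).colon {x} ∈ F)
    {d : ℕ → M →+ M} (hd : Δ.IsModuleHD d) :
    ∃! d' : ℕ → N →+ N, Δ.IsModuleHD d' ∧ ∀ (n : ℕ) (m : M), d' n (q m) = q (d n m) := by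
  have hS : F.IsClosedModule (Δ.TwistedSeries N) := TwistedSeries.isClosedModule hN
  obtain ⟨D, hD⟩ := hS.exists_extension q hker hcoker (hd.toSeries q)
  have hDq : ∀ n m, D (q m) n = q (d n m) := fun n m => congrFun (LinearMap.congr_fun hD m) n
  refine ⟨coeffs D, ⟨isModuleHD_coeffs D ?_, hDq⟩, ?_⟩
  -- The constant coefficient of `D` is linear and fixes the range of `q`, so uniqueness of
  -- extensions into `N` makes it the identity.
  · refine hN.linearMap_ext q hcoker (LinearMap.ext fun m => ?_)
    change D (q m) 0 = q m
    rw [hDq, hd.zero, AddMonoidHom.id_apply]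
  · rintro d' ⟨hd', h⟩
    -- The series map of any other extension agrees with `D` on the range of `q`, so uniqueness for
    -- maps into `N⟦x⟧` applies to all degrees at once.
    have hD' : hd'.toSeries LinearMap.id = D := by
      refine hS.linearMap_ext q hcoker (LinearMap.ext fun m => TwistedSeries.ext fun n => ?_)
      exact (h n m).trans (hDq n m).symm
    funext n
    ext1 x
    exact congrFun (LinearMap.congr_fun hD' x) n

end HigherDerivation

theorem mainTheorem3 {R : Type u} [Ring R] (τ : TorsionTheory Rᵐᵒᵖ) (hτ : τ.IsHereditary)
    (Δ : HigherDerivation R) (M : Type u) [AddCommGroup M] [Module Rᵐᵒᵖ M]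
    (d : ℕ → M →+ M) (hd : Δ.IsModuleHD d) :
    ∃! d' : ℕ → (τ.gabrielFilter hτ).moduleOfQuotients M →+
        (τ.gabrielFilter hτ).moduleOfQuotients M,
      Δ.IsModuleHD d' ∧
        ∀ (n : ℕ) (m : M),
          d' n ((τ.gabrielFilter hτ).toModuleOfQuotients M m) =
            (τ.gabrielFilter hτ).toModuleOfQuotients M (d n m) :=
  hd.existsUnique_extension ((τ.gabrielFilter hτ).isClosedModule_moduleOfQuotients M)
    ((τ.gabrielFilter hτ).toModuleOfQuotients M)
    ((τ.gabrielFilter hτ).isTorsionElem_of_toModuleOfQuotients_eq_zero M)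
    ((τ.gabrielFilter hτ).colon_range_toModuleOfQuotients_mem M)
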